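/- **Setting.** Let $d,n\ge 1$ and $r>0$, let $\mathbb B^d(r)$ be the closed Euclidean ball and $\mathbb S^{d-1}(r)$ the Euclidean sphere of radius $r$ about the origin in $\mathbb R^d$, and let $\varepsilon=(\varepsilon_1,\dots,\varepsilon_n)$ with $0<\varepsilon_i\le 1$. A channel (Markov kernel) $\mathcal C$ is $\varepsilon_0$-locally differentially private ($\varepsilon_0$-LDP) if $\Pr[\mathcal C(x)\in W]\le e^{\varepsilon_0}\Pr[\mathcal C(x')\in W]$ for all inputs $x,x'$ and all measurable $W$. An $\varepsilon$-LDP estimator consists of $\varepsilon_i$-LDP channels $\mathcal C_i$ on $\mathbb B^d(r)$ ($i=1,\dots,n$), applied independently to the users' data $X_1,\dots,X_n$, and a measurable function of the reports $Y_i=\mathcal C_i(X_i)$ computed by the server. *Hemisphere randomizer* (privacy parameter $\varepsilon_i$, input $X_i\in\mathbb B^d(r)$). Set $\tilde X_i=rX_i/\|X_i\|_2$ with probability $\frac12+\frac{\|X_i\|_2}{2r}$ and $\tilde X_i=-rX_i/\|X_i\|_2$ otherwise (if $X_i=0$, a fixed unit vector replaces $X_i/\|X_i\|_2$). Put $$B_i=r\,\frac{e^{\varepsilon_i}+1}{e^{\varepsilon_i}-1}\cdot\frac{\sqrt\pi}{2}\cdot\frac{d\,\Gamma\left(\frac{d-1}{2}+1\right)}{\Gamma\left(\frac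 d2+1\right)}.$$ With probability $\frac{e^{\varepsilon_i}}{e^{\varepsilon_i}+1}$ output $Y_i$ uniform on $\{y\in\mathbb S^{d-1}(B_i):\langle y,\tilde X_i\rangle>0\}$; otherwise output $Y_i$ uniform on $\{y\in\mathbb S^{d-1}(B_i):\langle y,\tilde X_i\rangle\le 0\}$. **Theorem.** There is a universal constant $c>0$ such that, for all $d,n\ge1$, $r>0$, $\varepsilon\in(0,1]^n$ and $\beta\in(0,1)$, writing $$\rho=c\,\frac{d+\log(1/\beta)}{\sum_{i=1}^n\varepsilon_i^2},$$ the following hold. 1. The estimator in which every user $i$ applies the hemisphere randomizer with parameter $\varepsilon_i$ and the server outputs $\hat\theta=\sum_i w_iY_i$ with $w_i=\varepsilon_i^2/\sum_j\varepsilon_j^2$ is $\varepsilon$-LDP and, for every probability distribution $P$ on $\mathbb B^d(r)$ with mean $\theta(P)$, if $X_1,\dots,X_n$ are i.i.d. from $P$, then $$\Pr\left[\|\hat\theta-\theta(P)\|_2^2\le r^2\rho\right]\ge 1-\beta .$$ 2. The estimator $\hat\theta'$ with the same channels, in which the server outputs $\sum_iw_iY_i$ if $\rho\le1$ and the zero vector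 if $\rho>1$, is $\varepsilon$-LDP and, for every such $P$, $$\Pr\left[\|\hat\theta'-\theta(P)\|_2^2\le r^2\min(\rho,1)\right]\ge 1-\beta .$$ -/

import Mathlib

namespace LDPMean

open MeasureTheory ProbabilityTheory

/-! ### Locally private channels and estimators -/

/-- A randomized map, given as a kernel, is `ε`-locally differentially private. -/
def IsLDP {X Y : Type*} [MeasurableSpace X] [MeasurableSpace Y] (ε : ℝ) (C : Kernel X Y) : Prop :=
  ∀ x x' : X, ∀ W : Set Y, MeasurableSet W → C x W ≤ ENNReal.ofReal (Real.exp ε) * C x' W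

/-- Users apply their channels independently: given data `x`, the reports are independent and
the `i`-th report has law `C i (x i)`. -/
noncomputable def productChannel {n : ℕ} {X Y : Type*} [MeasurableSpace X] [MeasurableSpace Y]
    (C : Fin n → Kernel X Y) [∀ i, IsMarkovKernel (C i)] : Kernel (Fin n → X) (Fin n → Y) where
  toFun x := Measure.pi fun i => C i (x i)
  measurable' := by
    refine Measurable.measure_of_isPiSystem_of_isProbabilityMeasure
      generateFrom_pi.symm isPiSystem_pi ?_
    rintro _ ⟨s, hs, rfl⟩
    simp only [Set.mem_pi, Set.mem_univ, forall_const, Set.mem_ofPred_eq] at hs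
    simp only [Measure.pi_pi]
    exact Finset.measurable_prod _ fun i _ =>
      ((C i).measurable_coe (hs i)).comp (measurable_pi_apply i)

/-- A (non-interactive) `ε`-locally differentially private estimator with values in `Θ`:
user `i` sends the output of an `ε i`-LDP channel applied to their own data point, and the
server applies a measurable function to the `n` reports. -/
structure LDPEstimator {n : ℕ} (ε : Fin n → ℝ) (X Y Θ : Type*)
    [MeasurableSpace X] [MeasurableSpace Y] [MeasurableSpace Θ] where
  channel : Fin n → Kernel X Y
  markov : ∀ i, IsMarkovKernel (channel i)
  ldp : ∀ i, IsLDP (ε i) (channel i)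
  aggregate : (Fin n → Y) → Θ
  measurable_aggregate : Measurable aggregate

/-- The law of the estimate when the `n` data points are drawn i.i.d. from `P`. -/
noncomputable def LDPEstimator.law {n : ℕ} {ε : Fin n → ℝ} {X Y Θ : Type*}
    [MeasurableSpace X] [MeasurableSpace Y] [MeasurableSpace Θ]
    (M : LDPEstimator ε X Y Θ) (P : Measure X) : Measure Θ :=
  haveI := M.markov
  ((Measure.pi fun _ : Fin n => P).bind (productChannel M.channel)).map M.aggregate

/-! ### The hemisphere randomizer -/

/-- `d`-dimensional Euclidean space. -/
abbrev E (d : ℕ) : Type := EuclideanSpace ℝ (Fin d)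

/-- The closed Euclidean ball of radius `r` about the origin, as a type. -/
abbrev Ball (d : ℕ) (r : ℝ) : Type := Metric.closedBall (0 : E d) r

/-- The surface measure of the unit sphere, transported to the sphere of radius `B` by scaling
(so the surface measure of that sphere up to a constant factor), as a measure on `ℝ^d`. -/
noncomputable def surface (d : ℕ) (B : ℝ) : Measure (E d) :=
  (volume : Measure (E d)).toSphere.map fun u : Metric.sphere (0 : E d) 1 => B • (u : E d)

/-- The uniform distribution on `{y ∈ 𝕊^{d-1}(B) : ⟨y, v⟩ > 0}`. -/
noncomputable def unifPos (d : ℕ) (B : ℝ) (v : E d) : Measure (E d) :=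
  cond (surface d B) {y | 0 < inner ℝ y v}

/-- The uniform distribution on `{y ∈ 𝕊^{d-1}(B) : ⟨y, v⟩ ≤ 0}`. -/
noncomputable def unifNonpos (d : ℕ) (B : ℝ) (v : E d) : Measure (E d) :=
  cond (surface d B) {y | inner ℝ y v ≤ 0}

/-- The direction of a vector; for the zero vector, a fixed unit vector is used. -/
noncomputable def direction {d : ℕ} [NeZero d] (x : E d) : E d :=
  open Classical in if x = 0 then EuclideanSpace.single 0 1 else ‖x‖⁻¹ • x

/-- The radius of the sphere on which the reports lie:
`r * (e^ε + 1) / (e^ε - 1) * (√π / 2) * d * Γ((d-1)/2 + 1) / Γ(d/2 + 1)`. -/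
noncomputable def reportRadius (d : ℕ) (r ε : ℝ) : ℝ :=
  (Real.exp ε + 1) / (Real.exp ε - 1) * r *
    (d * Real.sqrt Real.pi * Real.Gamma (((d : ℝ) - 1) / 2 + 1) /
      (2 * Real.Gamma ((d : ℝ) / 2 + 1)))

theorem measurable_direction {d : ℕ} [NeZero d] : Measurable (direction (d := d)) := by
  unfold direction
  exact Measurable.ite (measurableSet_singleton _) measurable_const
    (measurable_norm.inv.smul measurable_id)

instance (d : ℕ) (B : ℝ) : IsFiniteMeasure (surface d B) := by
  unfold surface; infer_instance

theorem measurable_cond_surface (d : ℕ) (B : ℝ) {S : Set (E d × E d)} (hS : MeasurableSet S) :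
    Measurable fun v : E d => cond (surface d B) (Prod.mk v ⁻¹' S) := by
  refine Measure.measurable_of_measurable_coe _ fun W hW => ?_
  have h (v : E d) : cond (surface d B) (Prod.mk v ⁻¹' S) W =
      (surface d B (Prod.mk v ⁻¹' S))⁻¹ *
        surface d B (Prod.mk v ⁻¹' (S ∩ Prod.snd ⁻¹' W)) := by
    rw [cond_apply (measurable_prodMk_left hS)]
    rfl
  simp_rw [h]
  exact (measurable_measure_prodMk_left hS).inv.mul
    (measurable_measure_prodMk_left (hS.inter (measurable_snd hW)))

theorem measurable_unifPos (d : ℕ) (B : ℝ) : Measurable (unifPos d B) :=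
  measurable_cond_surface d B (S := {q : E d × E d | 0 < inner ℝ q.2 q.1})
    (measurableSet_lt measurable_const (by fun_prop))

theorem measurable_unifNonpos (d : ℕ) (B : ℝ) : Measurable (unifNonpos d B) :=
  measurable_cond_surface d B (S := {q : E d × E d | inner ℝ q.2 q.1 ≤ 0})
    (measurableSet_le (by fun_prop) measurable_const)

/-- First step: `x` is rounded to `r x / ‖x‖` with probability `1/2 + ‖x‖ / (2r)`, and to
`- r x / ‖x‖` with probability `1/2 - ‖x‖ / (2r)`. -/
noncomputable def rounding (d : ℕ) [NeZero d] (r : ℝ) : Kernel (Ball d r) (E d) where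
  toFun x :=
    ENNReal.ofReal (1 / 2 + ‖(x : E d)‖ / (2 * r)) • Measure.dirac (r • direction (x : E d)) +
    ENNReal.ofReal (1 / 2 - ‖(x : E d)‖ / (2 * r)) • Measure.dirac (-(r • direction (x : E d)))
  measurable' := by
    have hm : Measurable fun x : Ball d r => r • direction (x : E d) :=
      (measurable_direction.comp measurable_subtype_coe).const_smul r
    refine Measure.measurable_of_measurable_coe _ fun W hW => ?_
    simp only [Measure.add_apply, Measure.smul_apply, smul_eq_mul]
    refine Measurable.add (Measurable.mul (by fun_prop) ?_) (Measurable.mul (by fun_prop) ?_)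
    · exact (Measure.measurable_coe hW).comp (Measure.measurable_dirac.comp hm)
    · exact (Measure.measurable_coe hW).comp (Measure.measurable_dirac.comp hm.neg)

/-- Second step: with probability `e^ε / (e^ε + 1)` the report is uniform on the open hemisphere
around `v` of the sphere of radius `B`, and otherwise uniform on the complementary hemisphere. -/
noncomputable def response (d : ℕ) (B ε : ℝ) : Kernel (E d) (E d) where
  toFun v :=
    ENNReal.ofReal (Real.exp ε / (Real.exp ε + 1)) • unifPos d B v +
    ENNReal.ofReal (1 / (Real.exp ε + 1)) • unifNonpos d B v
  measurable' := by
    refine Measure.measurable_of_measurable_coe _ fun W hW => ?_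
    simp only [Measure.add_apply, Measure.smul_apply, smul_eq_mul]
    exact (((Measure.measurable_coe hW).comp (measurable_unifPos d B)).const_mul _).add
      (((Measure.measurable_coe hW).comp (measurable_unifNonpos d B)).const_mul _)

/-- The hemisphere randomizer with privacy parameter `ε` for data in the ball of radius `r`. -/
noncomputable def hemisphereRandomizer (d : ℕ) [NeZero d] (r ε : ℝ) : Kernel (Ball d r) (E d) :=
  response d (reportRadius d r ε) ε ∘ₖ rounding d r

/-- The server's average of the reports, with weights proportional to `ε i ^ 2`. -/
noncomputable def weightedAverage {n d : ℕ} (ε : Fin n → ℝ) (y : Fin n → E d) : E d :=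
  ∑ i, (ε i ^ 2 / ∑ j, ε j ^ 2) • y i

end LDPMean

/-!
Write `g` for a standard Gaussian vector. In polar coordinates `g = ‖g‖ u` with `u` uniform on the
unit sphere and independent of `‖g‖`, so Jensen's inequality in the radial variable bounds the
moment generating function of `(𝔼 ‖g‖) u` by that of `g`: the uniform distribution on the sphere of
radius `B` is sub-Gaussian with parameter `(B / 𝔼 ‖g‖) ^ 2`. The normalisation of the hemisphere
randomizer is `B = r (e ^ ε + 1) / (e ^ ε - 1) * √(π / 2) * 𝔼 ‖g‖`; it makes the reports unbiased
and this parameter of order `r ^ 2 / ε ^ 2`, free of the dimension.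

The law of a report is at most twice the uniform distribution on the sphere. Such a domination
passes through `cosh`, which is at least `1`, to centred sub-Gaussian bounds at the cost of a
constant. The average with weights proportional to `ε i ^ 2` of the independent reports is thus
sub-Gaussian about the mean with parameter of order `r ^ 2 / ∑ i, ε i ^ 2`, and averaging its moment
generating function over a Gaussian direction yields the tail of its squared norm. When the server
truncates to zero, the error is at most `r`, as the mean lies in the ball.
-/

namespace LDPMean

open MeasureTheory ProbabilityTheory Set
open Module (finrank finrank_pos)
open scoped ENNReal NNReal

/-! ### Gaussian integrals -/

theorem integral_pow_mul_exp_neg_half_sq (m : ℕ) :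
    ∫ r in Ioi (0 : ℝ), r ^ m * Real.exp (-(1 / 2) * r ^ 2) =
      2 ^ (((m : ℝ) + 1) / 2) * (1 / 2) * Real.Gamma (((m : ℝ) + 1) / 2) := by
  have h := integral_rpow_mul_exp_neg_mul_rpow (p := 2) (q := m) (b := 1 / 2) (by norm_num)
    (by linarith [(Nat.cast_nonneg m : (0 : ℝ) ≤ m)]) (by norm_num)
  simp only [Real.rpow_natCast, Real.rpow_two] at h
  rw [h, one_div, Real.inv_rpow (by norm_num), ← Real.rpow_neg (by norm_num), neg_div, neg_neg]

theorem setIntegral_Ioi_id_gaussianReal (v : ℝ≥0) :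
    ∫ t in Ioi 0, t ∂gaussianReal 0 v = √v / √(2 * Real.pi) := by
  rcases eq_or_ne v 0 with rfl | hv
  · simp
  have : (0 : ℝ) < v := mod_cast pos_iff_ne_zero.2 hv
  have hmoment : ∫ t in Ioi (0 : ℝ), t * Real.exp (-(2 * v : ℝ)⁻¹ * t ^ 2) = v := by
    have h := integral_rpow_mul_exp_neg_mul_rpow (p := 2) (q := 1) (b := (2 * v : ℝ)⁻¹)
      two_pos (by norm_num) (by positivity)
    simp only [Real.rpow_one, Real.rpow_two] at h
    rw [h]
    norm_num [Real.rpow_neg_one]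
    ring
  have hdens (t : ℝ) : (gaussianPDF 0 v t).toReal • t =
      (√(2 * Real.pi * v))⁻¹ * (t * Real.exp (-(2 * v : ℝ)⁻¹ * t ^ 2)) := by
    rw [toReal_gaussianPDF, gaussianPDFReal, smul_eq_mul, sub_zero]
    ring_nf
  rw [gaussianReal_of_var_ne_zero _ hv, setIntegral_withDensity_eq_setIntegral_toReal_smul
    (measurable_gaussianPDF 0 v) (by simp [gaussianPDF]) _ measurableSet_Ioi]
  simp_rw [hdens]
  rw [integral_const_mul, hmoment, Real.sqrt_mul (by positivity), mul_inv, mul_assoc,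
    inv_mul_eq_div, inv_mul_eq_div, Real.div_sqrt]

theorem gaussianReal_Ioi_zero {v : ℝ≥0} (hv : v ≠ 0) : gaussianReal 0 v (Ioi 0) = 1 / 2 := by
  have := nullSingletonClass_gaussianReal (μ := 0) hv
  have hneg : gaussianReal 0 v (Iio 0) = gaussianReal 0 v (Ioi 0) := by
    conv_lhs => rw [← neg_zero, ← gaussianReal_map_neg, neg_zero]
    rw [Measure.map_apply measurable_neg measurableSet_Iio]
    simp
  have hadd := prob_add_prob_compl (μ := gaussianReal 0 v) (measurableSet_Ioi (a := (0 : ℝ)))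
  rw [compl_Ioi, ← measure_congr Iio_ae_eq_Iic, hneg, ← two_mul] at hadd
  rw [ENNReal.eq_div_iff (by norm_num) (by norm_num), hadd]

section InnerProductSpace

variable {V : Type*} [NormedAddCommGroup V] [InnerProductSpace ℝ V] [FiniteDimensional ℝ V]
  [MeasurableSpace V] [BorelSpace V]

/-- The density of the standard Gaussian measure of an `n`-dimensional Euclidean space with respect
to Lebesgue measure, as a function of the norm. -/
noncomputable def stdGaussianPDF (n : ℕ) (r : ℝ) : ℝ :=
  ((2 * Real.pi) ^ ((n : ℝ) / 2))⁻¹ * Real.exp (-(1 / 2) * r ^ 2)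

theorem stdGaussianPDF_nonneg (n : ℕ) (r : ℝ) : 0 ≤ stdGaussianPDF n r := by
  unfold stdGaussianPDF; positivity

@[fun_prop]
theorem measurable_stdGaussianPDF (n : ℕ) : Measurable (stdGaussianPDF n) := by
  unfold stdGaussianPDF; fun_prop

theorem integrable_stdGaussianPDF_norm :
    Integrable fun x : V => stdGaussianPDF (finrank ℝ V) ‖x‖ := by
  refine Integrable.const_mul (Integrable.of_integral_ne_zero ?_) _
  rw [GaussianFourier.integral_rexp_neg_mul_sq_norm (by norm_num)]
  positivity

theorem integral_cexp_inner_mul_stdGaussianPDF (t : V) :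
    ∫ x, stdGaussianPDF (finrank ℝ V) ‖x‖ • Complex.exp (inner ℝ x t * Complex.I) =
      Complex.exp (-‖t‖ ^ 2 / 2) := by
  have h := GaussianFourier.integral_cexp_neg_mul_sq_norm_add (V := V) (b := 1 / 2) (by norm_num)
    Complex.I t
  have hπ : ((2 * Real.pi : ℝ) : ℂ) ^ ((finrank ℝ V : ℂ) / 2) ≠ 0 := by
    simp [Complex.cpow_eq_zero_iff, Real.pi_ne_zero]
  have hexp (x : V) : stdGaussianPDF (finrank ℝ V) ‖x‖ • Complex.exp (inner ℝ x t * Complex.I) =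
      (((2 * Real.pi : ℝ) : ℂ) ^ ((finrank ℝ V : ℂ) / 2))⁻¹ *
        Complex.exp (-(1 / 2) * ‖x‖ ^ 2 + Complex.I * inner ℝ t x) := by
    rw [stdGaussianPDF, Complex.exp_add, real_inner_comm, mul_comm Complex.I, Complex.real_smul]
    push_cast [Complex.ofReal_cpow (show 0 ≤ 2 * Real.pi by positivity)]
    ring
  simp_rw [hexp]
  rw [integral_const_mul, h, inv_mul_eq_iff_eq_mul₀ hπ]
  congr 2
  · push_cast; ring
  · rw [Complex.I_sq]; ring

theorem stdGaussian_eq_withDensity :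
    stdGaussian V = volume.withDensity fun x =>
      ENNReal.ofReal (stdGaussianPDF (finrank ℝ V) ‖x‖) := by
  have := isFiniteMeasure_withDensity_ofReal (μ := (volume : Measure V))
    integrable_stdGaussianPDF_norm.2
  refine Measure.ext_of_charFun (funext fun t => ?_)
  rw [charFun_stdGaussian, charFun_apply, integral_withDensity_eq_integral_toReal_smul
    (by fun_prop) (by simp), ← integral_cexp_inner_mul_stdGaussianPDF]
  simp only [ENNReal.toReal_ofReal (stdGaussianPDF_nonneg _ _)]

theorem integral_stdGaussian {F : Type*} [NormedAddCommGroup F] [NormedSpace ℝ F] (f : V → F) :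
    ∫ x, f x ∂stdGaussian V = ∫ x, stdGaussianPDF (finrank ℝ V) ‖x‖ • f x := by
  rw [stdGaussian_eq_withDensity, integral_withDensity_eq_integral_toReal_smul
    (by fun_prop) (by simp)]
  simp only [ENNReal.toReal_ofReal (stdGaussianPDF_nonneg _ _)]

theorem integral_exp_mul_sq_norm_stdGaussian {s : ℝ} (hs : 2 * s < 1) :
    ∫ x : V, Real.exp (s * ‖x‖ ^ 2) ∂stdGaussian V = (1 - 2 * s) ^ (-(finrank ℝ V : ℝ) / 2) := by
  have hexp (x : V) : stdGaussianPDF (finrank ℝ V) ‖x‖ • Real.exp (s * ‖x‖ ^ 2) =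
      ((2 * Real.pi) ^ ((finrank ℝ V : ℝ) / 2))⁻¹ * Real.exp (-(1 / 2 - s) * ‖x‖ ^ 2) := by
    rw [stdGaussianPDF, smul_eq_mul, mul_assoc, ← Real.exp_add]
    ring_nf
  rw [integral_stdGaussian]
  simp_rw [hexp]
  rw [integral_const_mul, GaussianFourier.integral_rexp_neg_mul_sq_norm (by linarith),
    inv_mul_eq_div, ← Real.div_rpow (div_nonneg Real.pi_pos.le (by linarith)) (by positivity),
    neg_div, Real.rpow_neg (by linarith), ← Real.inv_rpow (by linarith)]
  congr 1
  have := Real.pi_ne_zero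
  have : 1 / 2 - s ≠ 0 := by linarith
  have : 1 - 2 * s ≠ 0 := by linarith
  field_simp

theorem stdGaussian_map_inner (w : V) :
    (stdGaussian V).map (fun x => inner ℝ w x) = gaussianReal 0 (‖w‖₊ ^ 2) := by
  have h := IsGaussian.map_eq_gaussianReal (μ := stdGaussian V) (innerSL ℝ w)
  rw [integral_strongDual_stdGaussian, variance_dual_stdGaussian, innerSL_apply_norm,
    Real.toNNReal_pow (norm_nonneg w), norm_toNNReal] at h
  exact h

theorem integral_exp_inner_stdGaussian (w : V) :
    ∫ x, Real.exp (inner ℝ w x) ∂stdGaussian V = Real.exp (‖w‖ ^ 2 / 2) := by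
  simpa [mgf] using mgf_gaussianReal (stdGaussian_map_inner w) 1

theorem integrable_exp_inner_stdGaussian (w : V) :
    Integrable (fun x => Real.exp (inner ℝ w x)) (stdGaussian V) := by
  refine Integrable.of_integral_ne_zero ?_
  rw [integral_exp_inner_stdGaussian]
  positivity

/-- The expected norm of a standard Gaussian vector. -/
noncomputable def chiMean (V : Type*) [NormedAddCommGroup V] [InnerProductSpace ℝ V]
    [FiniteDimensional ℝ V] [MeasurableSpace V] [BorelSpace V] : ℝ :=
  ∫ x : V, ‖x‖ ∂stdGaussian V

theorem integrable_norm_stdGaussian : Integrable (fun x : V => ‖x‖) (stdGaussian V) :=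
  Integrable.norm (f := fun x => x) IsGaussian.integrable_id

theorem exists_integral_norm_pow_stdGaussian_eq [Nontrivial V] :
    ∃ K : ℝ, ∀ k : ℕ, ∫ x : V, ‖x‖ ^ k ∂stdGaussian V =
      K * (2 ^ ((k : ℝ) / 2) * Real.Gamma (((finrank ℝ V : ℝ) + k) / 2)) := by
  obtain ⟨m, hm⟩ := Nat.exists_eq_succ_of_ne_zero (finrank_pos (R := ℝ) (M := V)).ne'
  refine ⟨finrank ℝ V * volume.real (Metric.ball (0 : V) 1) *
    ((2 * Real.pi) ^ ((finrank ℝ V : ℝ) / 2))⁻¹ * (2 ^ ((finrank ℝ V : ℝ) / 2) * (1 / 2)),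
    fun k => ?_⟩
  have hradial (r : ℝ) : r ^ m • (stdGaussianPDF (finrank ℝ V) r * r ^ k) =
      ((2 * Real.pi) ^ ((finrank ℝ V : ℝ) / 2))⁻¹ *
        (r ^ (m + k) * Real.exp (-(1 / 2) * r ^ 2)) := by
    rw [stdGaussianPDF, smul_eq_mul]; ring
  have hexponent : ((m + k : ℕ) : ℝ) + 1 = finrank ℝ V + k := by rw [hm]; push_cast; ring
  simp_rw [integral_stdGaussian, smul_eq_mul]
  rw [integral_fun_norm_addHaar volume fun r => stdGaussianPDF (finrank ℝ V) r * r ^ k,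
    show finrank ℝ V - 1 = m by omega]
  simp_rw [hradial]
  rw [integral_const_mul, integral_pow_mul_exp_neg_half_sq, hexponent, add_div (finrank ℝ V : ℝ),
    Real.rpow_add two_pos, nsmul_eq_mul, smul_eq_mul]
  ring

theorem chiMean_eq [Nontrivial V] :
    chiMean V = √2 * Real.Gamma (((finrank ℝ V : ℝ) + 1) / 2) /
      Real.Gamma ((finrank ℝ V : ℝ) / 2) := by
  have hΓ : Real.Gamma ((finrank ℝ V : ℝ) / 2) ≠ 0 :=
    (Real.Gamma_pos_of_pos (half_pos (mod_cast finrank_pos))).ne'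
  obtain ⟨K, hK⟩ := exists_integral_norm_pow_stdGaussian_eq (V := V)
  have h0 := hK 0
  have h1 := hK 1
  simp only [pow_zero, integral_const, probReal_univ, one_smul, CharP.cast_eq_zero, zero_div,
    Real.rpow_zero, one_mul, add_zero] at h0
  simp only [pow_one, Nat.cast_one, ← Real.sqrt_eq_rpow] at h1
  rw [chiMean, h1, eq_div_iff hΓ]
  linear_combination -(√2 * Real.Gamma (((finrank ℝ V : ℝ) + 1) / 2)) * h0

theorem chiMean_pos [Nontrivial V] : 0 < chiMean V := by
  have hdim : (0 : ℝ) < finrank ℝ V := mod_cast finrank_pos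
  have := Real.Gamma_pos_of_pos (half_pos hdim)
  have := Real.Gamma_pos_of_pos (show 0 < ((finrank ℝ V : ℝ) + 1) / 2 by positivity)
  rw [chiMean_eq]
  positivity

end InnerProductSpace

/-! ### Polar coordinates and the uniform distribution on a sphere -/

section NormedSpace

variable {V : Type*} [NormedAddCommGroup V] [NormedSpace ℝ V] [FiniteDimensional ℝ V]
  [Nontrivial V] [MeasurableSpace V] [BorelSpace V] (μ : Measure V) [μ.IsAddHaarMeasure]

theorem lintegral_polar {f : V → ℝ≥0∞} (hf : Measurable f) :
    ∫⁻ x, f x ∂μ = ∫⁻ u : Metric.sphere (0 : V) 1, ∫⁻ r in Ioi (0 : ℝ),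
      ENNReal.ofReal (r ^ (finrank ℝ V - 1)) * f (r • (u : V)) ∂volume ∂μ.toSphere := by
  have hpolar := μ.measurePreserving_homeomorphUnitSphereProd.lintegral_comp_emb
    (Homeomorph.measurableEmbedding _)
    (fun p : Metric.sphere (0 : V) 1 × Ioi (0 : ℝ) => f (p.2.1 • p.1.1))
  have hinv (x : ({(0)}ᶜ : Set V)) : f ((homeomorphUnitSphereProd V x).2.1 •
      (homeomorphUnitSphereProd V x).1.1) = f x := by
    have : (x : V) ≠ 0 := x.2
    simp [smul_smul, this]
  simp_rw [hinv] at hpolar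
  rw [lintegral_subtype_comap (measurableSet_singleton _).compl, restrict_compl_singleton,
    lintegral_prod _ (by fun_prop)] at hpolar
  rw [hpolar]
  refine lintegral_congr fun u => ?_
  rw [Measure.volumeIoiPow, lintegral_withDensity_eq_lintegral_mul _ (by fun_prop) (by fun_prop)]
  exact lintegral_subtype_comap measurableSet_Ioi
    (fun r => ENNReal.ofReal (r ^ (finrank ℝ V - 1)) * f (r • (u : V)))

theorem lintegral_withDensity_norm {f : ℝ → ℝ≥0∞} (hf : Measurable f) {g : V → ℝ≥0∞}
    (hg : Measurable g) :
    ∫⁻ x, g x ∂μ.withDensity (fun x => f ‖x‖) = ∫⁻ u : Metric.sphere (0 : V) 1,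
      ∫⁻ r in Ioi (0 : ℝ), ENNReal.ofReal (r ^ (finrank ℝ V - 1)) * (f r * g (r • (u : V)))
        ∂volume ∂μ.toSphere := by
  rw [lintegral_withDensity_eq_lintegral_mul _ (by fun_prop) hg, lintegral_polar _ (by fun_prop)]
  refine lintegral_congr fun u => setLIntegral_congr_fun measurableSet_Ioi fun r hr => ?_
  simp [norm_smul, abs_of_pos (mem_Ioi.1 hr)]

end NormedSpace

section InnerProductSpace

variable {V : Type*} [NormedAddCommGroup V] [InnerProductSpace ℝ V] [FiniteDimensional ℝ V]
  [MeasurableSpace V] [BorelSpace V]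

/-- The uniform distribution on the sphere of radius `B` about the origin of `V`, as a measure
on `V`. -/
noncomputable def uniformSphere (V : Type*) [NormedAddCommGroup V] [InnerProductSpace ℝ V]
    [FiniteDimensional ℝ V] [MeasurableSpace V] [BorelSpace V] (B : ℝ) : Measure V :=
  ((volume : Measure V).toSphere univ)⁻¹ •
    (volume : Measure V).toSphere.map fun u : Metric.sphere (0 : V) 1 => B • (u : V)

instance [Nontrivial V] (B : ℝ) : IsProbabilityMeasure (uniformSphere V B) := by
  refine ⟨?_⟩
  rw [uniformSphere, Measure.smul_apply, Measure.map_apply (by fun_prop) .univ, smul_eq_mul,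
    preimage_univ]
  exact ENNReal.inv_mul_cancel (Measure.measure_univ_ne_zero.2 (Measure.toSphere_ne_zero _))
    (measure_ne_top _ _)

theorem map_smul_uniformSphere_one (B : ℝ) :
    (uniformSphere V 1).map (B • ·) = uniformSphere V B := by
  rw [uniformSphere, uniformSphere, Measure.map_smul, Measure.map_map (by fun_prop) (by fun_prop)]
  simp [Function.comp_def]

theorem ae_norm_uniformSphere (B : ℝ) : ∀ᵐ y ∂uniformSphere V B, ‖y‖ = |B| := by
  refine Measure.ae_smul_measure ?_ _
  rw [ae_map_iff (by fun_prop) (measurableSet_eq_fun (by fun_prop) (by fun_prop))]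
  exact .of_forall fun u => by simp [norm_smul]

theorem lintegral_uniformSphere_one {f : V → ℝ≥0∞} (hf : Measurable f) :
    ∫⁻ u, f u ∂uniformSphere V 1 = ((volume : Measure V).toSphere univ)⁻¹ *
      ∫⁻ u : Metric.sphere (0 : V) 1, f u ∂(volume : Measure V).toSphere := by
  rw [uniformSphere, lintegral_smul_measure, lintegral_map hf (by fun_prop)]
  simp only [one_smul, smul_eq_mul]

theorem withDensity_norm_eq_map_prod_uniformSphere [Nontrivial V] {f : ℝ → ℝ≥0∞}
    (hf : Measurable f) :
    (volume : Measure V).withDensity (fun x => f ‖x‖) =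
      ((((volume : Measure V).withDensity fun x => f ‖x‖).map (‖·‖)).prod
        (uniformSphere V 1)).map fun p => p.1 • p.2 := by
  refine Measure.ext_of_lintegral _ fun g hg => ?_
  have hradial (u : Metric.sphere (0 : V) 1) :
      ∫⁻ r, g (r • (u : V)) ∂(((volume : Measure V).withDensity fun x : V => f ‖x‖).map (‖·‖)) =
        (volume : Measure V).toSphere univ * ∫⁻ r in Ioi (0 : ℝ),
          ENNReal.ofReal (r ^ (finrank ℝ V - 1)) * (f r * g (r • (u : V))) := by
    rw [lintegral_map (by fun_prop) (by fun_prop), lintegral_withDensity_norm _ hf (by fun_prop),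
      mul_comm, ← lintegral_const]
    refine lintegral_congr fun v => setLIntegral_congr_fun measurableSet_Ioi fun r hr => ?_
    simp [norm_smul, abs_of_pos (mem_Ioi.1 hr)]
  have hmeas : Measurable fun u : V =>
      ∫⁻ r, g (r • u) ∂(((volume : Measure V).withDensity fun x => f ‖x‖).map (‖·‖)) :=
    Measurable.lintegral_prod_left' (f := fun p : ℝ × V => g (p.1 • p.2)) (by fun_prop)
  rw [lintegral_withDensity_norm _ hf hg, lintegral_map hg (by fun_prop),
    lintegral_prod_symm' _ (by fun_prop), lintegral_uniformSphere_one hmeas]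
  simp_rw [hradial]
  rw [lintegral_const_mul' _ _ (measure_ne_top _ _), ENNReal.inv_mul_cancel_left
    (Measure.measure_univ_ne_zero.2 (Measure.toSphere_ne_zero _)) (measure_ne_top _ _)]

theorem stdGaussian_eq_map_prod_uniformSphere [Nontrivial V] :
    stdGaussian V = (((stdGaussian V).map (‖·‖)).prod (uniformSphere V 1)).map
      fun p => p.1 • p.2 := by
  rw [stdGaussian_eq_withDensity]
  exact withDensity_norm_eq_map_prod_uniformSphere
    (f := fun r => ENNReal.ofReal (stdGaussianPDF (finrank ℝ V) r)) (by fun_prop)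

theorem ae_ne_zero_stdGaussian [Nontrivial V] : ∀ᵐ x ∂stdGaussian V, x ≠ 0 := by
  rw [stdGaussian_eq_withDensity]
  exact (withDensity_absolutelyContinuous _ _).ae_le (Measure.ae_ne _ 0)

theorem stdGaussian_apply_of_forall_smul_mem_iff [Nontrivial V] {s : Set V}
    (hs : MeasurableSet s) (hcone : ∀ a : ℝ, 0 < a → ∀ x, a • x ∈ s ↔ x ∈ s) :
    stdGaussian V s = uniformSphere V 1 s := by
  have hpos : ∀ᵐ p ∂((stdGaussian V).map (‖·‖)).prod (uniformSphere V 1), 0 < p.1 := by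
    refine Measure.quasiMeasurePreserving_fst.ae ((ae_map_iff (by fun_prop) measurableSet_Ioi).2 ?_)
    exact ae_ne_zero_stdGaussian.mono fun x hx => norm_pos_iff.2 hx
  have hpre : (fun p : ℝ × V => p.1 • p.2) ⁻¹' s
      =ᵐ[((stdGaussian V).map (‖·‖)).prod (uniformSphere V 1)] univ ×ˢ s := by
    filter_upwards [hpos] with p hp
    exact propext ((hcone p.1 hp p.2).trans (iff_of_eq (true_and _)).symm)
  have := Measure.isProbabilityMeasure_map (μ := stdGaussian V) measurable_norm.aemeasurable
  rw [stdGaussian_eq_map_prod_uniformSphere, Measure.map_apply (by fun_prop) hs,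
    measure_congr hpre, Measure.prod_prod, measure_univ, one_mul]

theorem integral_stdGaussian_of_forall_smul [Nontrivial V] {F : Type*} [NormedAddCommGroup F]
    [NormedSpace ℝ F] {f : V → F} (hf : AEStronglyMeasurable f (stdGaussian V))
    (hhom : ∀ a : ℝ, 0 ≤ a → ∀ x, f (a • x) = a • f x) :
    ∫ x, f x ∂stdGaussian V = chiMean V • ∫ u, f u ∂uniformSphere V 1 := by
  have hnonneg : ∀ᵐ p ∂((stdGaussian V).map (‖·‖)).prod (uniformSphere V 1), 0 ≤ p.1 :=
    Measure.quasiMeasurePreserving_fst.ae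
      ((ae_map_iff (by fun_prop) measurableSet_Ici).2 (.of_forall norm_nonneg))
  have hf' := stdGaussian_eq_map_prod_uniformSphere (V := V) ▸ hf
  rw [chiMean, stdGaussian_eq_map_prod_uniformSphere, integral_map (by fun_prop) hf',
    integral_congr_ae (hnonneg.mono fun p hp => hhom p.1 hp p.2),
    integral_prod_smul (fun r : ℝ => r) f, ← stdGaussian_eq_map_prod_uniformSphere,
    integral_map (by fun_prop) (by fun_prop)]

end InnerProductSpace

/-! ### Half-spaces -/

theorem compl_inner_pos {V : Type*} [NormedAddCommGroup V] [InnerProductSpace ℝ V] (v : V) :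
    {y : V | 0 < inner ℝ y v}ᶜ = {y | inner ℝ y v ≤ 0} := by
  ext y; simp

section InnerProductSpace

variable {V : Type*} [NormedAddCommGroup V] [InnerProductSpace ℝ V] [FiniteDimensional ℝ V]
  [MeasurableSpace V] [BorelSpace V]

theorem measurableSet_inner_pos (v : V) : MeasurableSet {y : V | 0 < inner ℝ y v} :=
  measurableSet_lt measurable_const (by fun_prop)

theorem restrict_inner_pos_add_restrict_inner_nonpos (μ : Measure V) (v : V) :
    μ.restrict {y | 0 < inner ℝ y v} + μ.restrict {y | inner ℝ y v ≤ 0} = μ := by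
  rw [← compl_inner_pos, Measure.restrict_add_restrict_compl (measurableSet_inner_pos v)]

theorem stdGaussian_inner_pos {v : V} (hv : v ≠ 0) :
    stdGaussian V {y | 0 < inner ℝ y v} = 1 / 2 := by
  rw [← gaussianReal_Ioi_zero (v := ‖v‖₊ ^ 2) (by simpa using hv), ← stdGaussian_map_inner,
    Measure.map_apply (by fun_prop) measurableSet_Ioi]
  simp only [preimage, mem_Ioi, real_inner_comm]

theorem uniformSphere_inner_pos [Nontrivial V] {B : ℝ} (hB : 0 < B) {v : V} (hv : v ≠ 0) :
    uniformSphere V B {y | 0 < inner ℝ y v} = 1 / 2 := by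
  rw [← map_smul_uniformSphere_one, Measure.map_apply (by fun_prop) (measurableSet_inner_pos v),
    ← stdGaussian_inner_pos hv, stdGaussian_apply_of_forall_smul_mem_iff (measurableSet_inner_pos v)
      fun a ha x => by simp [real_inner_smul_left, ha]]
  simp [real_inner_smul_left, hB]

theorem uniformSphere_inner_nonpos [Nontrivial V] {B : ℝ} (hB : 0 < B) {v : V} (hv : v ≠ 0) :
    uniformSphere V B {y | inner ℝ y v ≤ 0} = 1 / 2 := by
  rw [← compl_inner_pos, prob_compl_eq_one_sub (measurableSet_inner_pos v),
    uniformSphere_inner_pos hB hv, one_div, ENNReal.one_sub_inv_two]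

theorem setIntegral_inner_pos_inner_stdGaussian (v : V) :
    ∫ x in {x | 0 < inner ℝ x v}, inner ℝ v x ∂stdGaussian V = ‖v‖ / √(2 * Real.pi) := by
  have h := setIntegral_Ioi_id_gaussianReal (‖v‖₊ ^ 2)
  rw [← stdGaussian_map_inner, setIntegral_map measurableSet_Ioi (by fun_prop) (by fun_prop)] at h
  simpa [preimage, real_inner_comm] using h

/- The first moment of a half-space is fixed by the reflection in the line orthogonal to its
boundary, hence lies on that line. -/
theorem setIntegral_inner_pos_stdGaussian (v : V) :
    ∫ x in {x | 0 < inner ℝ x v}, x ∂stdGaussian V = (√(2 * Real.pi) * ‖v‖)⁻¹ • v := by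
  have hint : Integrable (fun x : V => x) (stdGaussian V) := IsGaussian.integrable_id
  set I := ∫ x in {x | 0 < inner ℝ x v}, x ∂stdGaussian V with hI
  let R : V ≃ₗᵢ[ℝ] V := (ℝ ∙ v).reflection
  have hRv : R v = v :=
    Submodule.reflection_mem_subspace_eq_self (Submodule.mem_span_singleton_self v)
  have hRset : R ⁻¹' {x | 0 < inner ℝ x v} = {x | 0 < inner ℝ x v} := by
    ext x
    simp [← R.inner_map_map x v, hRv]
  have hRI : R I = I := by
    have h := setIntegral_map (μ := stdGaussian V) (f := fun x => x) (g := R)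
      (measurableSet_inner_pos v) (by fun_prop) (by fun_prop)
    rw [stdGaussian_map, hRset] at h
    rw [hI]
    conv_rhs => rw [h]
    exact (R.toContinuousLinearEquiv.integral_comp_comm _).symm
  obtain ⟨a, ha⟩ := Submodule.mem_span_singleton.1 ((Submodule.reflection_eq_self_iff I).1 hRI)
  rcases eq_or_ne v 0 with rfl | hv
  · simpa using ha.symm
  have hinner : a * ‖v‖ ^ 2 = ‖v‖ / √(2 * Real.pi) := by
    rw [← setIntegral_inner_pos_inner_stdGaussian, integral_inner hint.integrableOn, ← hI, ← ha,
      real_inner_smul_right, real_inner_self_eq_norm_sq]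
  rw [← ha]
  congr 1
  have := norm_ne_zero_iff.2 hv
  field_simp at hinner ⊢
  exact hinner

theorem integrable_id_uniformSphere [Nontrivial V] (B : ℝ) :
    Integrable (fun y : V => y) (uniformSphere V B) :=
  .of_bound (by fun_prop) |B| ((ae_norm_uniformSphere B).mono fun _ h => h.le)

theorem integral_id_uniformSphere [Nontrivial V] (B : ℝ) : ∫ y : V, y ∂uniformSphere V B = 0 := by
  have h := integral_stdGaussian_of_forall_smul (V := V) (f := fun x => x) (by fun_prop)
    fun _ _ _ => rfl
  rw [integral_id_stdGaussian, eq_comm, smul_eq_zero_iff_right chiMean_pos.ne'] at h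
  rw [← map_smul_uniformSphere_one, integral_map (by fun_prop) (by fun_prop), integral_smul, h,
    smul_zero]

theorem setIntegral_inner_pos_uniformSphere [Nontrivial V] {B : ℝ} (hB : 0 < B) (v : V) :
    ∫ y in {y | 0 < inner ℝ y v}, y ∂uniformSphere V B =
      (B / (√(2 * Real.pi) * chiMean V * ‖v‖)) • v := by
  have hs := measurableSet_inner_pos v
  have h := integral_stdGaussian_of_forall_smul
    (f := {x : V | 0 < inner ℝ x v}.indicator fun x => x) (by fun_prop) fun a ha x => by
      rcases ha.eq_or_lt with rfl | ha
      · simp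
      · simp [indicator, real_inner_smul_left, ha]
  rw [integral_indicator hs, integral_indicator hs, setIntegral_inner_pos_stdGaussian,
    ← inv_smul_eq_iff₀ chiMean_pos.ne'] at h
  rw [← map_smul_uniformSphere_one, setIntegral_map hs (by fun_prop) (by fun_prop), integral_smul]
  simp only [preimage, mem_ofPred_eq, real_inner_smul_left, mul_pos_iff_of_pos_left hB]
  rw [← h, smul_smul, smul_smul]
  congr 1
  field_simp

theorem setIntegral_inner_nonpos_uniformSphere [Nontrivial V] {B : ℝ} (hB : 0 < B) (v : V) :
    ∫ y in {y | inner ℝ y v ≤ 0}, y ∂uniformSphere V B =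
      -((B / (√(2 * Real.pi) * chiMean V * ‖v‖)) • v) := by
  rw [← compl_inner_pos, setIntegral_compl (measurableSet_inner_pos v)
    (integrable_id_uniformSphere B), integral_id_uniformSphere, zero_sub,
    setIntegral_inner_pos_uniformSphere hB]

end InnerProductSpace

/-! ### Sub-Gaussian vectors -/

section Domination

variable {Ω : Type*} [MeasurableSpace Ω] {μ ν : Measure Ω} [IsProbabilityMeasure μ] {X : Ω → ℝ}

theorem integral_cosh_le_rpow_of_le_smul [IsProbabilityMeasure ν] {C : ℝ≥0}
    (hX : Integrable (fun ω => Real.cosh (X ω)) ν) (hμν : μ ≤ C • ν) :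
    ∫ ω, Real.cosh (X ω) ∂μ ≤ (∫ ω, Real.cosh (X ω) ∂ν) ^ (C : ℝ) := by
  have hC : 1 ≤ C := by simpa using hμν univ
  have hmono : ∫ ω, (Real.cosh (X ω) - 1) ∂μ ≤ C * ∫ ω, (Real.cosh (X ω) - 1) ∂ν := by
    have h := integral_mono_measure hμν (.of_forall fun ω => sub_nonneg.2 (Real.one_le_cosh (X ω)))
      (hX.sub (integrable_const 1)).smul_measure_nnreal
    rwa [integral_smul_nnreal_measure, NNReal.smul_def] at h
  have hsub {m : Measure Ω} [IsProbabilityMeasure m]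
      (hm : Integrable (fun ω => Real.cosh (X ω)) m) :
      ∫ ω, (Real.cosh (X ω) - 1) ∂m = ∫ ω, Real.cosh (X ω) ∂m - 1 := by
    simp [integral_sub hm (integrable_const 1)]
  have hnonneg : 0 ≤ ∫ ω, (Real.cosh (X ω) - 1) ∂ν :=
    integral_nonneg fun ω => sub_nonneg.2 (Real.one_le_cosh (X ω))
  have hbernoulli := one_add_mul_self_le_rpow_one_add (s := ∫ ω, (Real.cosh (X ω) - 1) ∂ν)
    (by linarith) (NNReal.one_le_coe.2 hC)
  rw [hsub (hX.smul_measure_nnreal.mono_measure hμν)] at hmono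
  rw [hsub hX] at hmono hbernoulli
  rw [add_sub_cancel] at hbernoulli
  linarith

/- Jensen's inequality gives `exp (-𝔼 X) ≤ 𝔼 exp (-X)`, and `ab ≤ ((a + b) / 2) ^ 2`. -/
theorem integral_exp_sub_integral_le_sq_integral_cosh
    (hpos : Integrable (fun ω => Real.exp (X ω)) μ)
    (hneg : Integrable (fun ω => Real.exp (-X ω)) μ) :
    ∫ ω, Real.exp (X ω - μ[X]) ∂μ ≤ (∫ ω, Real.cosh (X ω) ∂μ) ^ 2 := by
  have hX : Integrable X μ := by
    simpa using integrable_pow_of_integrable_exp_mul one_ne_zero (by simpa using hpos)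
      (by simpa using hneg) 1
  have hjensen : Real.exp (-μ[X]) ≤ ∫ ω, Real.exp (-X ω) ∂μ := by
    simpa [integral_neg] using convexOn_exp.map_integral_le (f := fun ω => -X ω)
      Real.continuous_exp.continuousOn isClosed_univ (by simp) hX.neg hneg
  have hcosh : ∫ ω, Real.cosh (X ω) ∂μ =
      (∫ ω, Real.exp (X ω) ∂μ + ∫ ω, Real.exp (-X ω) ∂μ) / 2 := by
    simp_rw [Real.cosh_eq]
    rw [integral_div, integral_add hpos hneg]
  calc ∫ ω, Real.exp (X ω - μ[X]) ∂μ
      = (∫ ω, Real.exp (X ω) ∂μ) * Real.exp (-μ[X]) := by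
        simp_rw [sub_eq_add_neg, Real.exp_add, integral_mul_const]
    _ ≤ (∫ ω, Real.exp (X ω) ∂μ) * ∫ ω, Real.exp (-X ω) ∂μ := by gcongr
    _ ≤ (∫ ω, Real.cosh (X ω) ∂μ) ^ 2 := by
        rw [hcosh]
        linarith [sq_nonneg (∫ ω, Real.exp (X ω) ∂μ - ∫ ω, Real.exp (-X ω) ∂μ)]

theorem hasSubgaussianMGF_sub_integral_of_le_smul [IsProbabilityMeasure ν] {c C : ℝ≥0}
    (hX : HasSubgaussianMGF X c ν) (hμν : μ ≤ C • ν) :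
    HasSubgaussianMGF (fun ω => X ω - μ[X]) (2 * C * c) μ := by
  have hexp (t : ℝ) : Integrable (fun ω => Real.exp (t * X ω)) μ :=
    (hX.integrable_exp_mul t).smul_measure_nnreal.mono_measure hμν
  refine ⟨fun t => ?_, fun t => ?_⟩
  · simp_rw [mul_sub, Real.exp_sub]
    exact (hexp t).div_const _
  have hpos := hX.integrable_exp_mul t
  have hneg : Integrable (fun ω => Real.exp (-(t * X ω))) ν := by
    simpa using hX.integrable_exp_mul (-t)
  have hcosh : ∫ ω, Real.cosh (t * X ω) ∂ν ≤ Real.exp (c * t ^ 2 / 2) := by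
    have h₁ := hX.mgf_le t
    have h₂ := hX.mgf_le (-t)
    simp only [mgf, neg_sq, neg_mul] at h₁ h₂
    simp_rw [Real.cosh_eq]
    rw [integral_div, integral_add hpos hneg]
    linarith
  calc mgf (fun ω => X ω - μ[X]) μ t
      = ∫ ω, Real.exp (t * X ω - ∫ ω, t * X ω ∂μ) ∂μ := by
        simp_rw [mgf, integral_const_mul, mul_sub]
    _ ≤ (∫ ω, Real.cosh (t * X ω) ∂μ) ^ 2 :=
        integral_exp_sub_integral_le_sq_integral_cosh (hexp t) (by simpa using hexp (-t))
    _ ≤ ((∫ ω, Real.cosh (t * X ω) ∂ν) ^ (C : ℝ)) ^ 2 := by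
        have hint : Integrable (fun ω => Real.cosh (t * X ω)) ν := by
          simpa [Real.cosh_eq] using (hpos.add hneg).div_const 2
        have : 0 ≤ ∫ ω, Real.cosh (t * X ω) ∂μ := integral_nonneg fun ω => (Real.cosh_pos _).le
        gcongr
        exact integral_cosh_le_rpow_of_le_smul hint hμν
    _ ≤ (Real.exp (c * t ^ 2 / 2) ^ (C : ℝ)) ^ 2 := by
        have : 0 ≤ ∫ ω, Real.cosh (t * X ω) ∂ν := integral_nonneg fun ω => (Real.cosh_pos _).le
        gcongr
    _ = Real.exp ((2 * C * c : ℝ≥0) * t ^ 2 / 2) := by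
        rw [← Real.exp_mul, ← Real.exp_nat_mul]
        push_cast
        ring_nf

end Domination

section InnerProductSpace

variable {V : Type*} [NormedAddCommGroup V] [InnerProductSpace ℝ V] {Ω : Type*} [MeasurableSpace Ω]
  {μ ν : Measure Ω} {X : Ω → V} {c : ℝ≥0}

/-- A random vector is sub-Gaussian with parameter `c` if each of its one-dimensional marginals
`⟪w, X⟫` is sub-Gaussian with parameter `c * ‖w‖ ^ 2`. -/
def HasSubgaussianInner (X : Ω → V) (c : ℝ≥0) (μ : Measure Ω) : Prop :=
  ∀ w : V, HasSubgaussianMGF (fun ω => inner ℝ w (X ω)) (c * ‖w‖₊ ^ 2) μ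

theorem hasSubgaussianInner_iff :
    HasSubgaussianInner X c μ ↔ ∀ w : V, Integrable (fun ω => Real.exp (inner ℝ w (X ω))) μ ∧
      ∫ ω, Real.exp (inner ℝ w (X ω)) ∂μ ≤ Real.exp (c * ‖w‖ ^ 2 / 2) := by
  refine ⟨fun h w => ⟨by simpa using (h w).integrable_exp_mul 1,
    by simpa [mgf] using (h w).mgf_le 1⟩, fun h w => ⟨fun t => ?_, fun t => ?_⟩⟩
  · simpa [inner_smul_left] using (h (t • w)).1
  · have hw := (h (t • w)).2
    simp only [inner_smul_left, conj_trivial, norm_smul, Real.norm_eq_abs, mul_pow, sq_abs] at hw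
    refine hw.trans_eq ?_
    push_cast
    ring_nf

namespace HasSubgaussianInner

theorem mono {c' : ℝ≥0} (h : HasSubgaussianInner X c μ) (hc : c ≤ c') :
    HasSubgaussianInner X c' μ := by
  rw [hasSubgaussianInner_iff] at h ⊢
  exact fun w => ⟨(h w).1, (h w).2.trans (by gcongr)⟩

theorem comp_measurePreserving {Ω' : Type*} [MeasurableSpace Ω'] {ρ : Measure Ω'} {T : Ω' → Ω}
    (h : HasSubgaussianInner X c μ) (hT : MeasurePreserving T ρ μ) :
    HasSubgaussianInner (X ∘ T) c ρ := by
  intro w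
  have hw := h w
  rw [← hT.map_eq] at hw
  exact HasSubgaussianMGF.of_map (X := fun ω => inner ℝ w (X ω)) hT.aemeasurable hw

theorem const_smul (h : HasSubgaussianInner X c μ) (a : ℝ) :
    HasSubgaussianInner (fun ω => a • X ω) (‖a‖₊ ^ 2 * c) μ := by
  intro w
  convert h (a • w) using 1
  · simp_rw [inner_smul_left, inner_smul_right, conj_trivial]
  · rw [nnnorm_smul, mul_pow]
    ring

theorem sum {ι : Type*} {X : ι → Ω → V} {c : ι → ℝ≥0} [MeasurableSpace V] [BorelSpace V]
    (hindep : iIndepFun X μ) {s : Finset ι} (h : ∀ i ∈ s, HasSubgaussianInner (X i) (c i) μ) :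
    HasSubgaussianInner (fun ω => ∑ i ∈ s, X i ω) (∑ i ∈ s, c i) μ := by
  intro w
  simp_rw [inner_sum, Finset.sum_mul]
  exact HasSubgaussianMGF.sum_of_iIndepFun
    (hindep.comp (fun _ v => inner ℝ w v) fun _ => by fun_prop) fun i hi => h i hi w

theorem sub_integral_of_le_smul [CompleteSpace V] [IsProbabilityMeasure μ] [IsProbabilityMeasure ν]
    {C : ℝ≥0} (h : HasSubgaussianInner X c ν) (hX : Integrable X μ) (hμν : μ ≤ C • ν) :
    HasSubgaussianInner (fun ω => X ω - ∫ ω, X ω ∂μ) (2 * C * c) μ := by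
  intro w
  simp_rw [inner_sub_right, ← integral_inner hX w, mul_assoc (2 * C) c]
  exact hasSubgaussianMGF_sub_integral_of_le_smul (h w) hμν

/- A standard Gaussian `w` satisfies `𝔼 exp ⟪w, √(2s) x⟫ = exp (s * ‖x‖ ^ 2)`, which turns the
left-hand side into an average over `w` of moment generating functions of marginals of `X`. -/
theorem lintegral_exp_mul_sq_norm_le [FiniteDimensional ℝ V] [MeasurableSpace V] [BorelSpace V]
    [SFinite μ] (h : HasSubgaussianInner X c μ) (hX : AEMeasurable X μ) {s : ℝ} (hs : 0 ≤ s)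
    (hsc : 2 * (s * c) < 1) :
    ∫⁻ ω, ENNReal.ofReal (Real.exp (s * ‖X ω‖ ^ 2)) ∂μ ≤
      ENNReal.ofReal ((1 - 2 * (s * c)) ^ (-(finrank ℝ V : ℝ) / 2)) := by
  have hsq : √(2 * s) ^ 2 = 2 * s := Real.sq_sqrt (by positivity)
  have hlin (x : V) : ENNReal.ofReal (Real.exp (s * ‖x‖ ^ 2)) =
      ∫⁻ w, ENNReal.ofReal (Real.exp (inner ℝ (√(2 * s) • x) w)) ∂stdGaussian V := by
    rw [← ofReal_integral_eq_lintegral_ofReal (integrable_exp_inner_stdGaussian _)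
      (.of_forall fun _ => (Real.exp_pos _).le), integral_exp_inner_stdGaussian, norm_smul, mul_pow,
      Real.norm_eq_abs, sq_abs, hsq]
    ring_nf
  have hmarginal (w : V) : ∫⁻ ω, ENNReal.ofReal (Real.exp (inner ℝ (√(2 * s) • X ω) w)) ∂μ ≤
      ENNReal.ofReal (Real.exp (s * c * ‖w‖ ^ 2)) := by
    obtain ⟨hint, hle⟩ := hasSubgaussianInner_iff.1 (h.const_smul √(2 * s)) w
    simp_rw [real_inner_comm w]
    rw [← ofReal_integral_eq_lintegral_ofReal hint (.of_forall fun _ => (Real.exp_pos _).le)]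
    refine ENNReal.ofReal_le_ofReal (hle.trans_eq ?_)
    push_cast
    rw [Real.norm_eq_abs, sq_abs, hsq]
    ring_nf
  have hgauss := integral_exp_mul_sq_norm_stdGaussian (V := V) hsc
  have hint : Integrable (fun w : V => Real.exp (s * c * ‖w‖ ^ 2)) (stdGaussian V) :=
    .of_integral_ne_zero (hgauss ▸ (Real.rpow_pos_of_pos (by linarith) _).ne')
  simp_rw [hlin]
  rw [lintegral_lintegral_swap (by fun_prop), ← hgauss,
    ofReal_integral_eq_lintegral_ofReal hint (.of_forall fun _ => (Real.exp_pos _).le)]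
  exact lintegral_mono hmarginal

theorem one_sub_le_measureReal_sq_norm_le [FiniteDimensional ℝ V] [MeasurableSpace V] [BorelSpace V]
    [IsProbabilityMeasure μ] (h : HasSubgaussianInner X c μ) (hX : AEMeasurable X μ) (hc : 0 < c)
    {β t : ℝ} (hβ : 0 < β) (ht : 4 * c * (finrank ℝ V + Real.log (1 / β)) ≤ t) :
    1 - β ≤ μ.real {ω | ‖X ω‖ ^ 2 ≤ t} := by
  have : (0 : ℝ) < c := hc
  set s : ℝ := 1 / (4 * c)
  have hsc : s * c = 1 / 4 := by simp only [s]; field_simp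
  have hmoment : ∫⁻ ω, ENNReal.ofReal (Real.exp (s * ‖X ω‖ ^ 2)) ∂μ ≤
      ENNReal.ofReal (Real.exp (finrank ℝ V)) := by
    refine (h.lintegral_exp_mul_sq_norm_le hX (by positivity) (by linarith)).trans
      (ENNReal.ofReal_le_ofReal ?_)
    rw [hsc, Real.rpow_def_of_pos (by norm_num), show (1 : ℝ) - 2 * (1 / 4) = 2⁻¹ by norm_num,
      Real.log_inv]
    have := Real.log_two_lt_d9
    gcongr
    nlinarith [(finrank ℝ V).cast_nonneg (α := ℝ)]
  have hexp : Real.exp (finrank ℝ V + Real.log (1 / β)) = Real.exp (finrank ℝ V) / β := by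
    rw [Real.exp_add, Real.exp_log (by positivity), mul_one_div]
  have htail : μ {ω | ‖X ω‖ ^ 2 ≤ t}ᶜ ≤ ENNReal.ofReal β := calc
    μ {ω | ‖X ω‖ ^ 2 ≤ t}ᶜ
      ≤ μ {ω | ENNReal.ofReal (Real.exp (finrank ℝ V) / β) ≤
          ENNReal.ofReal (Real.exp (s * ‖X ω‖ ^ 2))} := by
        refine measure_mono fun ω hω => ENNReal.ofReal_le_ofReal ?_
        rw [← hexp, Real.exp_le_exp, one_div_mul_eq_div, le_div_iff₀' (by positivity)]
        exact ht.trans (not_le.1 (show ¬ ‖X ω‖ ^ 2 ≤ t from hω)).le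
    _ ≤ (∫⁻ ω, ENNReal.ofReal (Real.exp (s * ‖X ω‖ ^ 2)) ∂μ) /
          ENNReal.ofReal (Real.exp (finrank ℝ V) / β) :=
        meas_ge_le_lintegral_div (by fun_prop)
          (ENNReal.ofReal_pos.2 (by positivity)).ne' ENNReal.ofReal_ne_top
    _ ≤ ENNReal.ofReal (Real.exp (finrank ℝ V)) /
          ENNReal.ofReal (Real.exp (finrank ℝ V) / β) := by gcongr
    _ = ENNReal.ofReal β := by
        rw [← ENNReal.ofReal_div_of_pos (by positivity), div_div_cancel₀ (Real.exp_ne_zero _)]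
  have hcompl : μ.real {ω | ‖X ω‖ ^ 2 ≤ t}ᶜ ≤ β := ENNReal.toReal_le_of_le_ofReal hβ.le htail
  rw [probReal_compl_eq_one_sub₀ (nullMeasurableSet_le (by fun_prop) (by fun_prop))] at hcompl
  linarith

end HasSubgaussianInner

section UniformSphere

variable [FiniteDimensional ℝ V] [MeasurableSpace V] [BorelSpace V] [Nontrivial V]

/- In `stdGaussian V = (norm) • (direction)`, Jensen's inequality replaces the norm by its mean. -/
theorem integral_exp_chiMean_mul_inner_uniformSphere_le (w : V) :
    ∫ u, Real.exp (chiMean V * inner ℝ w u) ∂uniformSphere V 1 ≤ Real.exp (‖w‖ ^ 2 / 2) := by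
  have hprob := Measure.isProbabilityMeasure_map (μ := stdGaussian V) measurable_norm.aemeasurable
  have hint : Integrable (fun p : ℝ × V => Real.exp (inner ℝ w (p.1 • p.2)))
      (((stdGaussian V).map (‖·‖)).prod (uniformSphere V 1)) := by
    have h := integrable_exp_inner_stdGaussian w
    rw [stdGaussian_eq_map_prod_uniformSphere] at h
    exact h.comp_measurable (by fun_prop)
  have hnorm : Integrable (fun r : ℝ => r) ((stdGaussian V).map (‖·‖)) :=
    (integrable_map_measure (by fun_prop) (by fun_prop)).2 integrable_norm_stdGaussian
  have hmean : ∫ r, r ∂(stdGaussian V).map (‖·‖) = chiMean V :=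
    integral_map (by fun_prop) (by fun_prop)
  rw [← integral_exp_inner_stdGaussian, stdGaussian_eq_map_prod_uniformSphere,
    integral_map (by fun_prop) (by fun_prop), integral_prod_symm _ hint]
  refine integral_mono_of_nonneg (.of_forall fun _ => (Real.exp_pos _).le)
    hint.integral_prod_right ?_
  filter_upwards [hint.prod_left_ae] with u hu
  simp only [inner_smul_right] at hu ⊢
  rw [← hmean, ← integral_mul_const]
  exact convexOn_exp.map_integral_le (f := fun r => r * inner ℝ w u)
    Real.continuous_exp.continuousOn isClosed_univ (by simp) (hnorm.mul_const _) hu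

theorem hasSubgaussianInner_uniformSphere (B : ℝ) :
    HasSubgaussianInner (fun y : V => y) (‖B / chiMean V‖₊ ^ 2) (uniformSphere V B) := by
  have hχ := (chiMean_pos (V := V)).ne'
  refine hasSubgaussianInner_iff.2 fun w => ⟨?_, ?_⟩
  · refine Integrable.of_bound (by fun_prop) (Real.exp (‖w‖ * |B|)) ?_
    filter_upwards [ae_norm_uniformSphere B] with y hy
    rw [Real.norm_eq_abs, Real.abs_exp, Real.exp_le_exp, ← hy]
    exact real_inner_le_norm w y
  · rw [← map_smul_uniformSphere_one, integral_map (by fun_prop) (by fun_prop)]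
    convert integral_exp_chiMean_mul_inner_uniformSphere_le ((B / chiMean V) • w) using 4 with u
    · rw [inner_smul_left, inner_smul_right, conj_trivial, ← mul_assoc, mul_div_cancel₀ _ hχ]
    · simp [norm_smul, mul_pow]

end UniformSphere

end InnerProductSpace

/-! ### Privacy and unbiasedness of the hemisphere randomizer -/

section Kernel

variable {X Y : Type*} [MeasurableSpace X] [MeasurableSpace Y] {μ : Measure X}
  [IsProbabilityMeasure μ] {κ : Kernel X Y} {ν : Measure Y} {c : ℝ≥0∞}

theorem bind_le_smul (h : ∀ᵐ x ∂μ, κ x ≤ c • ν) : μ.bind κ ≤ c • ν := by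
  refine Measure.le_iff.2 fun s hs => ?_
  rw [Measure.bind_apply hs (Kernel.aemeasurable _)]
  refine (lintegral_mono_ae (h.mono fun x hx => hx s)).trans_eq ?_
  rw [lintegral_const, measure_univ, mul_one]

theorem smul_le_bind (h : ∀ᵐ x ∂μ, c • ν ≤ κ x) : c • ν ≤ μ.bind κ := by
  refine Measure.le_iff.2 fun s hs => ?_
  rw [Measure.bind_apply hs (Kernel.aemeasurable _)]
  refine Eq.trans_le ?_ (lintegral_mono_ae (h.mono fun x hx => hx s))
  rw [lintegral_const, measure_univ, mul_one]

theorem isProbabilityMeasure_bind (h : ∀ᵐ x ∂μ, IsProbabilityMeasure (κ x)) :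
    IsProbabilityMeasure (μ.bind κ) := by
  refine ⟨?_⟩
  rw [Measure.bind_apply .univ (Kernel.aemeasurable _),
    lintegral_congr_ae (h.mono fun x hx => hx.measure_univ), lintegral_one, measure_univ]

theorem isLDP_of_smul_le_of_le_smul {ε : ℝ} {b : ℝ≥0∞} (hlower : ∀ x, b • ν ≤ κ x)
    (hupper : ∀ x, κ x ≤ c • ν) (hc : c ≤ ENNReal.ofReal (Real.exp ε) * b) : IsLDP ε κ := by
  intro x x' W _
  calc κ x W ≤ c * ν W := hupper x W
    _ ≤ ENNReal.ofReal (Real.exp ε) * b * ν W := by gcongr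
    _ = ENNReal.ofReal (Real.exp ε) * (b * ν W) := mul_assoc _ _ _
    _ ≤ ENNReal.ofReal (Real.exp ε) * κ x' W := by gcongr; exact hlower x' W

end Kernel

section Response

variable {d : ℕ} [NeZero d] {B : ℝ} {v : E d}

instance : Nontrivial (E d) :=
  Module.nontrivial_of_finrank_pos (R := ℝ) (by simpa using NeZero.pos d)

theorem cond_surface (B : ℝ) (s : Set (E d)) :
    cond (surface d B) s = cond (uniformSphere (E d) B) s := by
  have h0 := Measure.measure_univ_ne_zero.2
    (Measure.toSphere_ne_zero (volume : Measure (E d)))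
  change _ = cond (((volume : Measure (E d)).toSphere univ)⁻¹ • surface d B) s
  rw [ProbabilityTheory.cond, ProbabilityTheory.cond, Measure.smul_apply, Measure.restrict_smul,
    smul_smul, smul_eq_mul, ENNReal.mul_inv (.inr (measure_ne_top _ _))
      (.inl (ENNReal.inv_ne_top.2 h0)), inv_inv, mul_right_comm,
    ENNReal.mul_inv_cancel h0 (measure_ne_top _ _), one_mul]

theorem response_apply (hB : 0 < B) (hv : v ≠ 0) (ε : ℝ) :
    response d B ε v =
      ENNReal.ofReal (2 * Real.exp ε / (Real.exp ε + 1)) •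
        (uniformSphere (E d) B).restrict {y | 0 < inner ℝ y v} +
      ENNReal.ofReal (2 / (Real.exp ε + 1)) •
        (uniformSphere (E d) B).restrict {y | inner ℝ y v ≤ 0} := by
  change ENNReal.ofReal (Real.exp ε / (Real.exp ε + 1)) • unifPos d B v +
    ENNReal.ofReal (1 / (Real.exp ε + 1)) • unifNonpos d B v = _
  have hdouble {a : ℝ} : ENNReal.ofReal a * (1 / 2 : ℝ≥0∞)⁻¹ = ENNReal.ofReal (a * 2) := by
    rw [one_div, inv_inv, ENNReal.ofReal_mul' two_pos.le, ENNReal.ofReal_ofNat]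
  rw [unifPos, unifNonpos, cond_surface, cond_surface, ProbabilityTheory.cond,
    ProbabilityTheory.cond, uniformSphere_inner_pos hB hv, uniformSphere_inner_nonpos hB hv,
    smul_smul, smul_smul, hdouble, hdouble]
  congr 3 <;> ring

theorem response_le_smul_uniformSphere (hB : 0 < B) (hv : v ≠ 0) {ε : ℝ} (hε : 0 ≤ ε) :
    response d B ε v ≤
      ENNReal.ofReal (2 * Real.exp ε / (Real.exp ε + 1)) • uniformSphere (E d) B := by
  have hexp : 1 ≤ Real.exp ε := Real.one_le_exp hε
  conv_rhs =>
    rw [← restrict_inner_pos_add_restrict_inner_nonpos (uniformSphere (E d) B) v, smul_add]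
  rw [response_apply hB hv]
  gcongr
  linarith

theorem smul_uniformSphere_le_response (hB : 0 < B) (hv : v ≠ 0) {ε : ℝ} (hε : 0 ≤ ε) :
    ENNReal.ofReal (2 / (Real.exp ε + 1)) • uniformSphere (E d) B ≤ response d B ε v := by
  have hexp : 1 ≤ Real.exp ε := Real.one_le_exp hε
  conv_lhs =>
    rw [← restrict_inner_pos_add_restrict_inner_nonpos (uniformSphere (E d) B) v, smul_add]
  rw [response_apply hB hv]
  gcongr
  linarith

theorem isProbabilityMeasure_response (hB : 0 < B) (hv : v ≠ 0) (ε : ℝ) :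
    IsProbabilityMeasure (response d B ε v) := by
  refine ⟨?_⟩
  have hhalf : (1 / 2 : ℝ≥0∞) = ENNReal.ofReal (1 / 2) := by
    rw [ENNReal.ofReal_div_of_pos two_pos, ENNReal.ofReal_one, ENNReal.ofReal_ofNat]
  simp only [response_apply hB hv, Measure.add_apply, Measure.smul_apply,
    Measure.restrict_apply_univ, uniformSphere_inner_pos hB hv, uniformSphere_inner_nonpos hB hv,
    smul_eq_mul, hhalf]
  rw [← ENNReal.ofReal_mul (by positivity), ← ENNReal.ofReal_mul (by positivity),
    ← ENNReal.ofReal_add (by positivity) (by positivity), ENNReal.ofReal_eq_one]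
  field_simp

theorem integral_response (hB : 0 < B) (hv : v ≠ 0) (ε : ℝ) :
    ∫ y, y ∂response d B ε v = ((Real.exp ε - 1) / (Real.exp ε + 1) *
      (B / (√(Real.pi / 2) * chiMean (E d)) / ‖v‖)) • v := by
  have hint := integrable_id_uniformSphere (V := E d) B
  have hsqrt : √(2 * Real.pi) = 2 * √(Real.pi / 2) := by
    rw [← Real.sqrt_sq two_pos.le, ← Real.sqrt_mul (by positivity), Real.sqrt_sq two_pos.le]
    ring_nf
  have := chiMean_pos (V := E d)
  have := norm_pos_iff.2 hv
  rw [response_apply hB hv, integral_add_measure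
    (hint.restrict.smul_measure ENNReal.ofReal_ne_top)
    (hint.restrict.smul_measure ENNReal.ofReal_ne_top), integral_smul_measure,
    integral_smul_measure, setIntegral_inner_pos_uniformSphere hB,
    setIntegral_inner_nonpos_uniformSphere hB, ENNReal.toReal_ofReal (by positivity),
    ENNReal.toReal_ofReal (by positivity), smul_neg, smul_smul, smul_smul, ← sub_eq_add_neg,
    ← sub_smul, hsqrt]
  congr 1
  field_simp

end Response

section Randomizer

variable {d : ℕ} [NeZero d] {r ε : ℝ}

theorem reportRadius_eq (d : ℕ) [NeZero d] (r ε : ℝ) :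
    reportRadius d r ε =
      (Real.exp ε + 1) / (Real.exp ε - 1) * r * (√(Real.pi / 2) * chiMean (E d)) := by
  have hd : (0 : ℝ) < d := Nat.cast_pos.2 (NeZero.pos d)
  rw [reportRadius, chiMean_eq, finrank_euclideanSpace_fin,
    show ((d : ℝ) - 1) / 2 + 1 = (d + 1) / 2 by ring,
    Real.Gamma_add_one (by positivity), Real.sqrt_div Real.pi_pos.le]
  congr 1
  field_simp

theorem reportRadius_pos (d : ℕ) [NeZero d] (hr : 0 < r) (hε : 0 < ε) :
    0 < reportRadius d r ε := by
  have := sub_pos.2 (Real.one_lt_exp_iff.2 hε)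
  have := chiMean_pos (V := E d)
  rw [reportRadius_eq]
  positivity

theorem integral_response_reportRadius (hr : 0 < r) (hε : 0 < ε) {v : E d} (hv : ‖v‖ = r) :
    ∫ y, y ∂response d (reportRadius d r ε) ε v = v := by
  have := sub_pos.2 (Real.one_lt_exp_iff.2 hε)
  have := chiMean_pos (V := E d)
  rw [integral_response (reportRadius_pos d hr hε) (norm_pos_iff.1 (hv ▸ hr)), reportRadius_eq, hv]
  convert one_smul ℝ v
  field_simp

theorem norm_direction (x : E d) : ‖direction x‖ = 1 := by
  unfold direction
  split_ifs with h
  · simp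
  · exact norm_smul_inv_norm h

theorem norm_smul_direction (x : E d) : ‖x‖ • direction x = x := by
  unfold direction
  split_ifs with h
  · simp [h]
  · exact smul_inv_smul₀ (norm_ne_zero_iff.2 h) x

theorem norm_div_two_mul_le_half {d : ℕ} (hr : 0 < r) (x : Ball d r) :
    ‖(x : E d)‖ / (2 * r) ≤ 1 / 2 := by
  rw [div_le_div_iff₀ (by positivity) two_pos]
  linarith [mem_closedBall_zero_iff.1 x.2]

theorem isMarkovKernel_rounding (d : ℕ) [NeZero d] (hr : 0 < r) :
    IsMarkovKernel (rounding d r) := by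
  refine ⟨fun x => ⟨?_⟩⟩
  have := norm_div_two_mul_le_half hr x
  change (ENNReal.ofReal _ • Measure.dirac _ + ENNReal.ofReal _ • Measure.dirac _ : Measure (E d))
    univ = 1
  rw [Measure.add_apply, Measure.smul_apply, Measure.smul_apply, measure_univ, measure_univ,
    smul_eq_mul, smul_eq_mul, mul_one, mul_one, ← ENNReal.ofReal_add (by positivity) (by linarith),
    ENNReal.ofReal_eq_one]
  ring

theorem ae_norm_rounding (hr : 0 < r) (x : Ball d r) : ∀ᵐ v ∂rounding d r x, ‖v‖ = r := by
  have hnorm : ‖r • direction (x : E d)‖ = r := by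
    rw [norm_smul, norm_direction, mul_one, Real.norm_of_nonneg hr.le]
  refine ae_add_measure_iff.2 ⟨Measure.ae_smul_measure ?_ _, Measure.ae_smul_measure ?_ _⟩
  · rwa [ae_dirac_eq]
  · rwa [ae_dirac_eq, Filter.eventually_pure, norm_neg]

theorem integral_rounding (hr : 0 < r) (x : Ball d r) : ∫ v, v ∂rounding d r x = x := by
  have := norm_div_two_mul_le_half hr x
  have hint (v : E d) (a : ℝ) :
      Integrable (fun v => v) (ENNReal.ofReal a • Measure.dirac v) :=
    (integrable_dirac (by finiteness)).smul_measure ENNReal.ofReal_ne_top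
  change ∫ v, v ∂(ENNReal.ofReal _ • Measure.dirac _ + ENNReal.ofReal _ • Measure.dirac _) = _
  rw [integral_add_measure (hint _ _) (hint _ _), integral_smul_measure, integral_smul_measure,
    integral_dirac, integral_dirac, ENNReal.toReal_ofReal (by positivity),
    ENNReal.toReal_ofReal (by linarith), smul_neg, smul_smul, smul_smul, ← sub_eq_add_neg,
    ← sub_smul]
  conv_rhs => rw [← norm_smul_direction (x : E d)]
  congr 1
  field_simp
  ring

theorem isMarkovKernel_hemisphereRandomizer (d : ℕ) [NeZero d] (hr : 0 < r) (hε : 0 < ε) :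
    IsMarkovKernel (hemisphereRandomizer d r ε) := by
  have := isMarkovKernel_rounding d hr
  refine ⟨fun x => ?_⟩
  rw [hemisphereRandomizer, Kernel.comp_apply]
  exact isProbabilityMeasure_bind <| (ae_norm_rounding hr x).mono fun v hv =>
    isProbabilityMeasure_response (reportRadius_pos d hr hε) (norm_pos_iff.1 (hv ▸ hr)) ε

theorem hemisphereRandomizer_le_smul_uniformSphere (hr : 0 < r) (hε : 0 < ε) (x : Ball d r) :
    hemisphereRandomizer d r ε x ≤ ENNReal.ofReal (2 * Real.exp ε / (Real.exp ε + 1)) •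
      uniformSphere (E d) (reportRadius d r ε) := by
  have := isMarkovKernel_rounding d hr
  rw [hemisphereRandomizer, Kernel.comp_apply]
  exact bind_le_smul <| (ae_norm_rounding hr x).mono fun v hv =>
    response_le_smul_uniformSphere (reportRadius_pos d hr hε) (norm_pos_iff.1 (hv ▸ hr)) hε.le

theorem smul_uniformSphere_le_hemisphereRandomizer (hr : 0 < r) (hε : 0 < ε) (x : Ball d r) :
    ENNReal.ofReal (2 / (Real.exp ε + 1)) • uniformSphere (E d) (reportRadius d r ε) ≤
      hemisphereRandomizer d r ε x := by
  have := isMarkovKernel_rounding d hr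
  rw [hemisphereRandomizer, Kernel.comp_apply]
  exact smul_le_bind <| (ae_norm_rounding hr x).mono fun v hv =>
    smul_uniformSphere_le_response (reportRadius_pos d hr hε) (norm_pos_iff.1 (hv ▸ hr)) hε.le

theorem isLDP_hemisphereRandomizer (d : ℕ) [NeZero d] (hr : 0 < r) (hε : 0 < ε) :
    IsLDP ε (hemisphereRandomizer d r ε) := by
  refine isLDP_of_smul_le_of_le_smul (smul_uniformSphere_le_hemisphereRandomizer hr hε)
    (hemisphereRandomizer_le_smul_uniformSphere hr hε) ?_
  rw [← ENNReal.ofReal_mul (Real.exp_pos ε).le]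
  exact ENNReal.ofReal_le_ofReal (le_of_eq (by ring))

theorem bind_hemisphereRandomizer_le_smul_uniformSphere (hr : 0 < r) (hε : 0 < ε)
    (P : Measure (Ball d r)) [IsProbabilityMeasure P] :
    P.bind (hemisphereRandomizer d r ε) ≤
      (2 : ℝ≥0) • uniformSphere (E d) (reportRadius d r ε) := by
  have hle : ENNReal.ofReal (2 * Real.exp ε / (Real.exp ε + 1)) ≤ (2 : ℝ≥0) := by
    rw [ENNReal.ofReal_le_iff_le_toReal ENNReal.coe_ne_top, div_le_iff₀ (by positivity)]
    simp
  refine bind_le_smul (c := ((2 : ℝ≥0) : ℝ≥0∞)) (.of_forall fun x => ?_)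
  exact (hemisphereRandomizer_le_smul_uniformSphere hr hε x).trans (by gcongr)

theorem integrable_id_bind_hemisphereRandomizer (hr : 0 < r) (hε : 0 < ε)
    (P : Measure (Ball d r)) [IsProbabilityMeasure P] :
    Integrable (fun y : E d => y) (P.bind (hemisphereRandomizer d r ε)) :=
  (integrable_id_uniformSphere _).smul_measure_nnreal.mono_measure
    (bind_hemisphereRandomizer_le_smul_uniformSphere hr hε P)

theorem integral_hemisphereRandomizer (hr : 0 < r) (hε : 0 < ε) (x : Ball d r) :
    ∫ y, y ∂hemisphereRandomizer d r ε x = x := by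
  have hint := integrable_id_bind_hemisphereRandomizer hr hε (Measure.dirac x)
  rw [Measure.dirac_bind (Kernel.measurable _), hemisphereRandomizer] at hint
  rw [hemisphereRandomizer, Kernel.integral_comp hint, ← integral_rounding hr x]
  exact integral_congr_ae <| (ae_norm_rounding hr x).mono fun v hv =>
    integral_response_reportRadius hr hε hv

theorem integral_bind_hemisphereRandomizer (hr : 0 < r) (hε : 0 < ε) (P : Measure (Ball d r))
    [IsProbabilityMeasure P] :
    ∫ y, y ∂P.bind (hemisphereRandomizer d r ε) = ∫ x, (x : E d) ∂P := by
  have hint := integrable_id_bind_hemisphereRandomizer hr hε P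
  rw [Measure.comp_eq_comp_const_apply] at hint ⊢
  rw [Kernel.integral_comp hint]
  simp only [Kernel.const_apply, integral_hemisphereRandomizer hr hε]

end Randomizer

/-! ### Concentration of the weighted average -/

theorem lintegral_pi_prod {ι : Type*} [Fintype ι] {X : ι → Type*} [∀ i, MeasurableSpace (X i)]
    (μ : ∀ i, Measure (X i)) [∀ i, IsProbabilityMeasure (μ i)] {f : ∀ i, X i → ℝ≥0∞}
    (hf : ∀ i, Measurable (f i)) :
    ∫⁻ x, ∏ i, f i (x i) ∂Measure.pi μ = ∏ i, ∫⁻ y, f i y ∂μ i := by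
  have hindep : iIndepFun (fun i (x : ∀ i, X i) => f i (x i)) (Measure.pi μ) :=
    iIndepFun_pi fun i => (hf i).aemeasurable
  rw [lintegral_prod_eq_prod_lintegral_of_indepFun _ _ hindep fun i => by fun_prop]
  exact Finset.prod_congr rfl fun i _ => (measurePreserving_eval μ i).lintegral_comp (hf i)

theorem pi_bind_productChannel {n : ℕ} {X Y : Type*} [MeasurableSpace X] [MeasurableSpace Y]
    (C : Fin n → Kernel X Y) [∀ i, IsMarkovKernel (C i)] (P : Fin n → Measure X)
    [∀ i, IsProbabilityMeasure (P i)] :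
    (Measure.pi P).bind (productChannel C) = Measure.pi fun i => (P i).bind (C i) := by
  refine (Measure.pi_eq fun s hs => ?_).symm
  have happly (x : Fin n → X) : productChannel C x (univ.pi s) = ∏ i, C i (x i) (s i) :=
    Measure.pi_pi _ _
  rw [Measure.bind_apply (.univ_pi hs) (Kernel.aemeasurable _)]
  simp_rw [happly]
  rw [lintegral_pi_prod _ fun i => (C i).measurable_coe (hs i)]
  exact Finset.prod_congr rfl fun i _ => (Measure.bind_apply (hs i) (Kernel.aemeasurable _)).symm

theorem nnnorm_sq_reportRadius_div_chiMean_le (d : ℕ) [NeZero d] (r : ℝ) {ε : ℝ} (hε : 0 < ε)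
    (hε1 : ε ≤ 1) : ‖reportRadius d r ε / chiMean (E d)‖₊ ^ 2 ≤ 32 * ‖r‖₊ ^ 2 / ‖ε‖₊ ^ 2 := by
  have hexp : ε ≤ Real.exp ε - 1 := by linarith [Real.add_one_le_exp ε]
  have hexp3 : Real.exp ε ≤ 3 := by
    linarith [Real.exp_le_exp.2 hε1, Real.exp_one_lt_d9]
  have hratio : (Real.exp ε + 1) / (Real.exp ε - 1) ≤ 4 / ε := by
    gcongr
    linarith
  have hratio_nonneg : 0 ≤ (Real.exp ε + 1) / (Real.exp ε - 1) :=
    div_nonneg (by positivity) (hε.le.trans hexp)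
  rw [reportRadius_eq, ← mul_assoc, mul_div_cancel_right₀ _ chiMean_pos.ne', ← NNReal.coe_le_coe]
  push_cast
  simp only [Real.norm_eq_abs, sq_abs]
  calc ((Real.exp ε + 1) / (Real.exp ε - 1) * r * √(Real.pi / 2)) ^ 2
      = ((Real.exp ε + 1) / (Real.exp ε - 1)) ^ 2 * r ^ 2 * (Real.pi / 2) := by
        rw [mul_pow, mul_pow, Real.sq_sqrt (by positivity)]
    _ ≤ (4 / ε) ^ 2 * r ^ 2 * 2 := by
        gcongr
        linarith [Real.pi_le_four]
    _ = 32 * r ^ 2 / ε ^ 2 := by ring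

theorem hasSubgaussianInner_bind_hemisphereRandomizer {d : ℕ} [NeZero d] {r ε : ℝ} (hr : 0 < r)
    (hε : 0 < ε) (hε1 : ε ≤ 1) (P : Measure (Ball d r)) [IsProbabilityMeasure P] :
    HasSubgaussianInner (fun y => y - ∫ x, (x : E d) ∂P) (128 * ‖r‖₊ ^ 2 / ‖ε‖₊ ^ 2)
      (P.bind (hemisphereRandomizer d r ε)) := by
  have := isMarkovKernel_hemisphereRandomizer d hr hε
  have h := (hasSubgaussianInner_uniformSphere _).sub_integral_of_le_smul
    (integrable_id_bind_hemisphereRandomizer hr hε P)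
    (bind_hemisphereRandomizer_le_smul_uniformSphere hr hε P)
  rw [integral_bind_hemisphereRandomizer hr hε P] at h
  refine h.mono ?_
  calc 2 * 2 * ‖reportRadius d r ε / chiMean (E d)‖₊ ^ 2
      ≤ 2 * 2 * (32 * ‖r‖₊ ^ 2 / ‖ε‖₊ ^ 2) := by
        gcongr
        exact nnnorm_sq_reportRadius_div_chiMean_le d r hε hε1
    _ = 128 * ‖r‖₊ ^ 2 / ‖ε‖₊ ^ 2 := by ring

theorem measurable_weightedAverage {n d : ℕ} (ε : Fin n → ℝ) :
    Measurable (weightedAverage (d := d) ε) := by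
  unfold weightedAverage
  fun_prop

section WeightedAverage

variable {n d : ℕ} [NeZero n] {ε : Fin n → ℝ}

theorem weightedAverage_sub (hε : ∀ i, ε i ≠ 0) (y : Fin n → E d) (θ : E d) :
    weightedAverage ε y - θ = ∑ i, (ε i ^ 2 / ∑ j, ε j ^ 2) • (y i - θ) := by
  have hpos : 0 < ∑ i, ε i ^ 2 :=
    Finset.sum_pos (fun i _ => sq_pos_of_ne_zero (hε i)) Finset.univ_nonempty
  simp only [weightedAverage, smul_sub, Finset.sum_sub_distrib, ← Finset.sum_smul,
    ← Finset.sum_div, div_self hpos.ne', one_smul]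

theorem hasSubgaussianInner_weightedAverage_sub (hε : ∀ i, ε i ≠ 0) {μ : Fin n → Measure (E d)}
    [∀ i, IsProbabilityMeasure (μ i)] {θ : E d} {c : ℝ≥0}
    (h : ∀ i, HasSubgaussianInner (fun y => y - θ) (c / ‖ε i‖₊ ^ 2) (μ i)) :
    HasSubgaussianInner (fun y => weightedAverage ε y - θ) (c / ∑ i, ‖ε i‖₊ ^ 2)
      (Measure.pi μ) := by
  set T := ∑ i, ‖ε i‖₊ ^ 2 with hT
  have hTpos : 0 < T := Finset.sum_pos (fun i _ => by simpa [pos_iff_ne_zero] using hε i)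
    Finset.univ_nonempty
  have hweight (i : Fin n) : ‖ε i ^ 2 / ∑ j, ε j ^ 2‖₊ = ‖ε i‖₊ ^ 2 / T := by
    ext
    simp [hT, abs_of_nonneg (Finset.sum_nonneg fun j (_ : j ∈ Finset.univ) => sq_nonneg (ε j))]
  have hcoord (i : Fin n) :
      HasSubgaussianInner (fun y : Fin n → E d => y i - θ) (c / ‖ε i‖₊ ^ 2) (Measure.pi μ) :=
    (h i).comp_measurePreserving (measurePreserving_eval μ i)
  have hsum := HasSubgaussianInner.sum (s := Finset.univ)
    (iIndepFun_pi (μ := μ) (X := fun i y => (ε i ^ 2 / ∑ j, ε j ^ 2) • (y - θ))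
      fun i => by fun_prop)
    fun i _ => (hcoord i).const_smul _
  simp_rw [weightedAverage_sub hε]
  refine hsum.mono (le_of_eq ?_)
  calc ∑ i, ‖ε i ^ 2 / ∑ j, ε j ^ 2‖₊ ^ 2 * (c / ‖ε i‖₊ ^ 2)
      = ∑ i, c / T ^ 2 * ‖ε i‖₊ ^ 2 := by
        refine Finset.sum_congr rfl fun i _ => ?_
        have := nnnorm_ne_zero_iff.2 (hε i)
        rw [hweight]
        field_simp
    _ = c / T := by
        rw [← Finset.mul_sum, ← hT]
        field_simp

theorem one_sub_le_measureReal_sq_norm_weightedAverage_sub_le [NeZero d] {r β : ℝ} (hr : 0 < r)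
    (hε : ∀ i, 0 < ε i ∧ ε i ≤ 1) (hβ : 0 < β) (P : Measure (Ball d r)) [IsProbabilityMeasure P] :
    1 - β ≤ (Measure.pi fun i => P.bind (hemisphereRandomizer d r (ε i))).real
      {y | ‖weightedAverage ε y - ∫ x, (x : E d) ∂P‖ ^ 2 ≤
        r ^ 2 * (512 * ((d + Real.log (1 / β)) / ∑ i, ε i ^ 2))} := by
  have (i : Fin n) := isMarkovKernel_hemisphereRandomizer d hr (hε i).1
  have hsubgaussian := hasSubgaussianInner_weightedAverage_sub (fun i => (hε i).1.ne') fun i =>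
    hasSubgaussianInner_bind_hemisphereRandomizer hr (hε i).1 (hε i).2 P
  refine hsubgaussian.one_sub_le_measureReal_sq_norm_le
    ((measurable_weightedAverage ε).sub_const _).aemeasurable ?_ hβ (le_of_eq ?_)
  · have : 0 < ∑ i, ‖ε i‖₊ ^ 2 :=
      Finset.sum_pos (fun i _ => pow_pos (nnnorm_pos.2 (hε i).1.ne') 2) Finset.univ_nonempty
    have := nnnorm_pos.2 hr.ne'
    positivity
  · push_cast
    simp only [finrank_euclideanSpace_fin, Real.norm_eq_abs, sq_abs]
    ring

end WeightedAverage

theorem norm_integral_ball_le {d : ℕ} {r : ℝ} (P : Measure (Ball d r)) [IsProbabilityMeasure P] :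
    ‖∫ x, (x : E d) ∂P‖ ≤ r := by
  simpa using norm_integral_le_of_norm_le_const (μ := P) (f := fun x : Ball d r => (x : E d))
    (C := r) (.of_forall fun x => mem_closedBall_zero_iff.1 x.2)

theorem one_sub_le_measureReal_sq_norm_ite_sub_le {V Ω : Type*} [NormedAddCommGroup V]
    [MeasurableSpace Ω] {μ : Measure Ω} [IsProbabilityMeasure μ] {T : Ω → V} {θ : V} {r ρ β : ℝ}
    (hθ : ‖θ‖ ≤ r) (hβ : 0 ≤ β) (h : 1 - β ≤ μ.real {ω | ‖T ω - θ‖ ^ 2 ≤ r ^ 2 * ρ}) :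
    1 - β ≤ μ.real {ω | ‖(if ρ ≤ 1 then T ω else 0) - θ‖ ^ 2 ≤ r ^ 2 * min ρ 1} := by
  rcases le_or_gt ρ 1 with hρ | hρ
  · simpa only [if_pos hρ, min_eq_left hρ] using h
  · have hmem : ‖θ‖ ^ 2 ≤ r ^ 2 := by gcongr
    simpa [hρ.not_ge, min_eq_right hρ.le, hmem] using hβ

/-- The estimator in which every user applies the hemisphere randomizer and the server applies an
arbitrary measurable function `g` to the reports. -/
noncomputable def hemisphereEstimator {n d : ℕ} [NeZero d] {r : ℝ} {ε : Fin n → ℝ} (hr : 0 < r)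
    (hε : ∀ i, 0 < ε i) (g : (Fin n → E d) → E d) (hg : Measurable g) :
    LDPEstimator ε (Ball d r) (E d) (E d) where
  channel i := hemisphereRandomizer d r (ε i)
  markov i := isMarkovKernel_hemisphereRandomizer d hr (hε i)
  ldp i := isLDP_hemisphereRandomizer d hr (hε i)
  aggregate := g
  measurable_aggregate := hg

theorem measureReal_law_hemisphereEstimator {n d : ℕ} [NeZero d] {r : ℝ} {ε : Fin n → ℝ}
    (hr : 0 < r) (hε : ∀ i, 0 < ε i) {g : (Fin n → E d) → E d} (hg : Measurable g)
    (P : Measure (Ball d r)) [IsProbabilityMeasure P] {s : Set (E d)} (hs : MeasurableSet s) :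
    ((hemisphereEstimator hr hε g hg).law P).real s =
      (Measure.pi fun i => P.bind (hemisphereRandomizer d r (ε i))).real (g ⁻¹' s) := by
  have (i : Fin n) := isMarkovKernel_hemisphereRandomizer d hr (hε i)
  rw [← pi_bind_productChannel (fun i => hemisphereRandomizer d r (ε i)) fun _ => P]
  exact map_measureReal_apply hg hs

end LDPMean

open MeasureTheory ProbabilityTheory LDPMean in
theorem mainTheorem1 :
    ∃ c : ℝ, 0 < c ∧
      ∀ (n d : ℕ) [NeZero n] [NeZero d] (r : ℝ) (ε : Fin n → ℝ) (β : ℝ),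
        0 < r → (∀ i, 0 < ε i ∧ ε i ≤ 1) → 0 < β → β < 1 →
        -- the hemisphere randomizer followed by the weighted average
        (∃ M : LDPEstimator ε (Ball d r) (E d) (E d),
          (∀ i, M.channel i = hemisphereRandomizer d r (ε i)) ∧
          M.aggregate = weightedAverage ε ∧
          ∀ P : Measure (Ball d r), IsProbabilityMeasure P →
            1 - β ≤ (M.law P).real {t | ‖t - ∫ x, (x : E d) ∂P‖ ^ 2 ≤
              r ^ 2 * (c * ((d + Real.log (1 / β)) / ∑ i, ε i ^ 2))}) ∧
        -- the same, except that the server outputs zero when the bound above exceeds `r ^ 2`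
        (∃ M : LDPEstimator ε (Ball d r) (E d) (E d),
          (∀ i, M.channel i = hemisphereRandomizer d r (ε i)) ∧
          (M.aggregate = fun y =>
            if c * ((d + Real.log (1 / β)) / ∑ i, ε i ^ 2) ≤ 1 then weightedAverage ε y else 0) ∧
          ∀ P : Measure (Ball d r), IsProbabilityMeasure P →
            1 - β ≤ (M.law P).real {t | ‖t - ∫ x, (x : E d) ∂P‖ ^ 2 ≤
              r ^ 2 * min (c * ((d + Real.log (1 / β)) / ∑ i, ε i ^ 2)) 1}) := by
  refine ⟨512, by norm_num, fun n d _ _ r ε β hr hε hβ _ => ?_⟩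
  have hmeas := measurable_weightedAverage (d := d) ε
  have hball (θ : E d) (t : ℝ) : MeasurableSet {z : E d | ‖z - θ‖ ^ 2 ≤ t} :=
    measurableSet_le (by fun_prop) measurable_const
  have hmarkov (i : Fin n) := isMarkovKernel_hemisphereRandomizer d hr (hε i).1
  refine ⟨⟨hemisphereEstimator hr (fun i => (hε i).1) _ hmeas, fun _ => rfl, rfl, fun P _ => ?_⟩,
    ⟨hemisphereEstimator hr (fun i => (hε i).1) _ (hmeas.ite (.const _) measurable_const),
      fun _ => rfl, rfl, fun P _ => ?_⟩⟩ <;>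
    rw [measureReal_law_hemisphereEstimator _ _ _ _ (hball _ _)]
  · exact one_sub_le_measureReal_sq_norm_weightedAverage_sub_le hr hε hβ P
  · exact one_sub_le_measureReal_sq_norm_ite_sub_le (norm_integral_ball_le P) hβ.le
      (one_sub_le_measureReal_sq_norm_weightedAverage_sub_le hr hε hβ P)
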